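/- **de Finetti's theorem.** Let $(E,\mathcal B)$ be a Borel space, i.e. a measurable space isomorphic to a Borel subset of $\mathbb R$, and let $X=(X_n)_{n\in\mathbb N}$ be a sequence of $E$-valued random variables on a probability space $(\Omega,\mathcal A,\mathbb P)$. Assume that $X$ is exchangeable, meaning that the distribution of $X$ on the sequence space $(E_\infty,\mathcal B_\infty)=(E,\mathcal B)^{\mathbb N}$ is invariant under $(x_n)_n\mapsto(x_{\pi(n)})_n$ for every bijection $\pi:\mathbb N\to\mathbb N$ with $\pi(i)\neq i$ for only finitely many $i$. Let $\mathcal M_1(E)$ be the set of probability measures on $(E,\mathcal B)$ with the $\sigma$-field generated by the maps $\mu\mapsto\mu(A)$, $A\in\mathcal B$. Then there is a random variable $M:\Omega\to\mathcal M_1(E)$ such that, conditionally on $M=\mu$, the $X_n$ are i.i.d. with common distribution $\mu$; that is, the probability kernel $Q(\mu,\cdot)=\mu^{\otimes\mathbb N}$ from $\mathcal M_1(E)$ to $E_\infty$ is the conditional distribution of $X$ given $M$: $$\mathbb P(M\in B,\,X\in A)=\int_B \mu^{\otimes\mathbb N}(A)\,\mathbb P^M(d\mu)\qquad\text{for all measurable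 } B\subseteq\mathcal M_1(E),\ A\in\mathcal B_\infty,$$ where $\mathbb P^M$ denotes the distribution of $M$. In particular, for all $k\in\mathbb N$ and $A_1,\dots,A_k\in\mathcal B$, $$\mathbb P(X_1\in A_1,\dots,X_k\in A_k)=\int\prod_{i=1}^k\mu(A_i)\,\mathbb P^M(d\mu),$$ and $\mathbb P(X\in A)=\int \mu^{\otimes\mathbb N}(A)\,\mathbb P^M(d\mu)$ for all $A\in\mathcal B_\infty$. -/

import Mathlib

open MeasureTheory ProbabilityTheory

namespace DeFinetti

variable {Ω E : Type*} [MeasurableSpace Ω] [MeasurableSpace E]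

/-- The map `(xₙ)ₙ ↦ (x_{π(n)})ₙ` on sequences induced by a permutation `π` of `ℕ`. -/
def permSeq (π : Equiv.Perm ℕ) (x : ℕ → E) : ℕ → E := fun n => x (π n)

/-- The path map `ω ↦ (Xₙ(ω))ₙ` of a sequence of random variables. -/
def path (X : ℕ → Ω → E) (ω : Ω) : ℕ → E := fun n => X n ω

/-- A sequence `X` is exchangeable if its distribution on the path space `ℕ → E` (with the product
`σ`-algebra) is invariant under all permutations of `ℕ` that move only finitely many points. -/
def Exchangeable (X : ℕ → Ω → E) (P : Measure Ω) : Prop :=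
  ∀ π : Equiv.Perm ℕ, {i : ℕ | π i ≠ i}.Finite →
    (P.map (path X)).map (permSeq π) = P.map (path X)

/-- The law `μ^{⊗ℕ}` depends measurably on the probability measure `μ`. -/
theorem measurable_iidLaw :
    Measurable (fun μ : ProbabilityMeasure E =>
      Measure.infinitePi (fun _ : ℕ => (μ : Measure E))) := by
  refine Measurable.measure_of_isPiSystem_of_isProbabilityMeasure
    (S := squareCylinders (fun _ : ℕ => {s : Set E | MeasurableSet s}))
    (generateFrom_squareCylinders (α := fun _ : ℕ => E)).symm
    (isPiSystem_squareCylinders (fun _ => MeasurableSpace.isPiSystem_measurableSet)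
      (fun _ => MeasurableSet.univ)) ?_
  rintro _ ⟨s, t, ht, rfl⟩
  have ht' : ∀ i, MeasurableSet (t i) := fun i => ht i (Set.mem_univ i)
  have h : (fun μ : ProbabilityMeasure E =>
      Measure.infinitePi (fun _ : ℕ => (μ : Measure E)) ((s : Set ℕ).pi t)) =
      fun μ : ProbabilityMeasure E => ∏ i ∈ s, (μ : Measure E) (t i) := by
    funext μ
    exact Measure.infinitePi_pi _ (fun i _ => ht' i)
  rw [h]
  exact Finset.measurable_fun_prod s fun i _ =>
    (Measure.measurable_coe (ht' i)).comp measurable_subtype_coe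

/-- The probability kernel `Q(μ, ·) = μ^{⊗ℕ}` from the probability measures on `E` to the path
space: `Q(μ, ·)` is the law of an i.i.d. sequence with common distribution `μ`. -/
noncomputable def iidKernel (E : Type*) [MeasurableSpace E] :
    Kernel (ProbabilityMeasure E) (ℕ → E) where
  toFun μ := Measure.infinitePi (fun _ : ℕ => (μ : Measure E))
  measurable' := measurable_iidLaw

instance : IsMarkovKernel (iidKernel E) :=
  ⟨fun μ => inferInstanceAs
    (IsProbabilityMeasure (Measure.infinitePi (fun _ : ℕ => (μ : Measure E))))⟩

end DeFinetti

namespace DeFinetti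

open scoped ENNReal

variable {Ω E β : Type*} [MeasurableSpace Ω] [MeasurableSpace E] [MeasurableSpace β]

/-! Exchangeability makes the law invariant under injective reindexing, as every finite marginal
sees only finitely many indices. Let `κ` be the conditional distribution of `X 0` given its future.
By this invariance, `κ` is also the conditional distribution of each `X n` given any later tail of
the sequence.

The candidate is `M = κ(X 1, X 2, …)`. For each `A`, `κ(later tail)(A)` is a conditional expectation
of `κ(X 1, X 2, …)(A)` and has the same law. A projection that preserves the second moment changes
nothing, so the two agree almost surely (`ae_eq_comp_of_hasCondDistrib`). Hence `M` is, up to null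
sets, a function of every tail, and each `X n` has conditional distribution `M` given its future.
Integrating out one coordinate at a time gives the product formula (`lintegral_prod_indicator_mul`).
Neither a tail σ-field nor martingale convergence is needed. -/

theorem measurable_path {X : ℕ → Ω → E} (hX : ∀ n, Measurable (X n)) : Measurable (path X) :=
  measurable_pi_lambda _ hX

/-! ### Invariance under injective reindexing -/

/-- An injective map of `ℕ` agrees on each initial segment with a permutation of finite support. -/
theorem exists_perm_eq_of_injective {φ : ℕ → ℕ} (hφ : Function.Injective φ) (N : ℕ) :
    ∃ π : Equiv.Perm ℕ, {i : ℕ | π i ≠ i}.Finite ∧ ∀ i < N, π i = φ i := by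
  induction N with
  | zero => exact ⟨1, by simp, by simp⟩
  | succ N ih =>
    obtain ⟨π, hfin, hπ⟩ := ih
    -- The swap corrects the value at `N`. By injectivity, earlier values are neither `π N` nor `φ
    -- N`, so they are kept.
    refine ⟨Equiv.swap (π N) (φ N) * π, ?_, fun i hi => ?_⟩
    · refine (hfin.union (Set.toFinite {N, π.symm (φ N)})).subset fun i hi => ?_
      by_contra hcon
      simp only [Set.mem_union, Set.mem_ofPred_eq, Set.mem_insert_iff, Set.mem_singleton_iff,
        not_or, not_not] at hcon
      apply hi
      have h1 : π i ≠ π N := fun h => hcon.2.1 (π.injective h)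
      have h2 : π i ≠ φ N := fun h => hcon.2.2 (by rw [← h, Equiv.symm_apply_apply])
      rw [Equiv.Perm.mul_apply, Equiv.swap_apply_of_ne_of_ne h1 h2, hcon.1]
    · rcases Nat.lt_succ_iff_lt_or_eq.mp hi with h | rfl
      · have h1 : π i ≠ π N := fun h' => h.ne (π.injective h')
        have h2 : π i ≠ φ N := by
          rw [hπ i h]
          exact fun h' => h.ne (hφ h')
        rw [Equiv.Perm.mul_apply, Equiv.swap_apply_of_ne_of_ne h1 h2, hπ i h]
      · simp

/-- The law of an exchangeable sequence is invariant under passing to reindexed subsequences. -/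
theorem Exchangeable.map_comp_injective {P : Measure Ω} [IsFiniteMeasure P] {X : ℕ → Ω → E}
    (hX : ∀ n, Measurable (X n)) (h : Exchangeable X P) {φ : ℕ → ℕ}
    (hφ : Function.Injective φ) :
    P.map (path fun n => X (φ n)) = P.map (path X) := by
  refine (map_eq_iff_forall_finset_map_restrict_eq (X := fun n => X (φ n)) (Y := X)
    (by fun_prop) (by fun_prop)).2 fun I => ?_
  obtain ⟨π, hfin, hπ⟩ := exists_perm_eq_of_injective hφ (I.sup id + 1)
  have hpath : Measurable (path X) := measurable_path hX
  have hperm : Measurable (permSeq (E := E) π) :=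
    measurable_pi_lambda _ fun n => measurable_pi_apply _
  have key := congrArg (fun ν => ν.map I.restrict) (h π hfin)
  rw [Measure.map_map hperm hpath,
    Measure.map_map (by fun_prop) (hperm.comp hpath),
    Measure.map_map (by fun_prop) hpath] at key
  refine Eq.trans ?_ key
  congr 1
  ext ω i
  have hi : (i : ℕ) < I.sup id + 1 := Nat.lt_succ_of_le (Finset.le_sup (f := id) i.2)
  simp [permSeq, path, hπ i hi]

/-! ### Rigidity of conditional distributions -/

/-- Integration of a product against a conditional distribution. -/
theorem lintegral_indicator_mul_of_hasCondDistrib {P : Measure Ω} [SFinite P]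
    {U : Ω → E} {V : Ω → β} {κ : Kernel β E} [IsSFiniteKernel κ]
    (h : HasCondDistrib U V κ P) (hV : Measurable V)
    {A : Set E} (hA : MeasurableSet A) {g : β → ℝ≥0∞} (hg : Measurable g) :
    ∫⁻ ω, A.indicator 1 (U ω) * g (V ω) ∂P = ∫⁻ ω, κ (V ω) A * g (V ω) ∂P := by
  have hf : Measurable fun p : β × E => A.indicator (1 : E → ℝ≥0∞) p.2 * g p.1 :=
    ((measurable_one.indicator hA).comp measurable_snd).mul (hg.comp measurable_fst)
  have h1 := lintegral_map' (μ := P) (f := fun p : β × E => A.indicator (1 : E → ℝ≥0∞) p.2 * g p.1)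
    hf.aemeasurable h.aemeasurable
  rw [← h1, h.map_eq, Measure.lintegral_compProd hf, lintegral_map _ hV]
  · refine lintegral_congr fun ω => ?_
    simp only
    rw [lintegral_mul_const _ (measurable_one.indicator hA), lintegral_indicator_one hA]
  · exact hf.lintegral_kernel_prod_right'

/-- Two `[0, 1]`-valued functions whose second moments and mixed moment all agree are
almost everywhere equal. -/
theorem ae_eq_of_lintegral_mul_eq {P : Measure Ω} [IsFiniteMeasure P] {a b : Ω → ℝ≥0∞}
    (ha : Measurable a) (hb : Measurable b) (ha1 : ∀ ω, a ω ≤ 1) (hb1 : ∀ ω, b ω ≤ 1)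
    (h1 : ∫⁻ ω, a ω * b ω ∂P = ∫⁻ ω, b ω * b ω ∂P)
    (h2 : ∫⁻ ω, a ω * a ω ∂P = ∫⁻ ω, b ω * b ω ∂P) : a =ᵐ[P] b := by
  have conv : ∀ {u v : Ω → ℝ≥0∞}, Measurable u → Measurable v → (∀ ω, u ω ≤ 1) → (∀ ω, v ω ≤ 1) →
      Integrable (fun ω => (u ω).toReal * (v ω).toReal) P ∧
      ∫ ω, (u ω).toReal * (v ω).toReal ∂P = (∫⁻ ω, u ω * v ω ∂P).toReal := by
    intro u v hu hv hu1 hv1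
    have hle : ∀ ω, u ω * v ω ≤ 1 := fun ω => mul_le_one' (hu1 ω) (hv1 ω)
    simp_rw [← ENNReal.toReal_mul]
    refine ⟨integrable_toReal_of_lintegral_ne_top (hu.mul hv).aemeasurable ?_,
      integral_toReal (hu.mul hv).aemeasurable
        (ae_of_all _ fun ω => (hle ω).trans_lt ENNReal.one_lt_top)⟩
    refine ((lintegral_mono hle).trans_lt ?_).ne
    simp [measure_lt_top]
  obtain ⟨iab, eab⟩ := conv ha hb ha1 hb1
  obtain ⟨iaa, eaa⟩ := conv ha ha ha1 ha1
  obtain ⟨ibb, ebb⟩ := conv hb hb hb1 hb1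
  -- The moments force `a - b` to have zero `L²` norm; the expansion is done in `ℝ`, where
  -- subtraction is not truncated.
  have hsq : (fun ω => ((a ω).toReal - (b ω).toReal) ^ 2) = fun ω =>
      (a ω).toReal * (a ω).toReal - 2 * ((a ω).toReal * (b ω).toReal)
        + (b ω).toReal * (b ω).toReal := by
    funext ω
    ring
  have iab2 := iab.const_mul 2
  have isub : Integrable (fun ω => (a ω).toReal * (a ω).toReal
      - 2 * ((a ω).toReal * (b ω).toReal)) P := iaa.sub iab2
  have hint : Integrable (fun ω => ((a ω).toReal - (b ω).toReal) ^ 2) P := by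
    rw [hsq]
    exact isub.add ibb
  have hzero : ∫ ω, ((a ω).toReal - (b ω).toReal) ^ 2 ∂P = 0 := by
    rw [hsq, integral_add isub ibb, integral_sub iaa iab2, integral_const_mul,
      eab, eaa, ebb, h1, h2]
    ring
  have hae := (integral_eq_zero_iff_of_nonneg (fun ω => sq_nonneg _) hint).1 hzero
  filter_upwards [hae] with ω hω
  have : (a ω).toReal - (b ω).toReal = 0 := by simpa using hω
  exact (ENNReal.toReal_eq_toReal_iff' ((ha1 ω).trans_lt ENNReal.one_lt_top).ne
    ((hb1 ω).trans_lt ENNReal.one_lt_top).ne).1 (sub_eq_zero.1 this)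

/-- If conditioning on `V` and on the coarser `T ∘ V`, of the same law as `V`, gives the same
conditional distribution `κ`, then `κ` takes the same value at both. -/
theorem ae_eq_comp_of_hasCondDistrib [StandardBorelSpace E] [Nonempty E]
    {P : Measure Ω} [IsFiniteMeasure P]
    {U : Ω → E} {V : Ω → β} {κ : Kernel β E} [IsMarkovKernel κ] {T : β → β}
    (hU : Measurable U) (hV : Measurable V) (hT : Measurable T)
    (h1 : HasCondDistrib U V κ P) (h2 : HasCondDistrib U (T ∘ V) κ P)
    (hlaw : P.map (T ∘ V) = P.map V) :
    ∀ᵐ ω ∂P, κ (V ω) = κ (T (V ω)) := by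
  have hset : ∀ A, MeasurableSet A → (fun ω => κ (V ω) A) =ᵐ[P] fun ω => κ (T (V ω)) A := by
    intro A hA
    have hκ := κ.measurable_coe hA
    refine ae_eq_of_lintegral_mul_eq (hκ.comp hV) (hκ.comp (hT.comp hV))
      (fun _ => prob_le_one) (fun _ => prob_le_one) ?_ ?_
    -- The integral of `1_A(U) κ(T V)(A)` is evaluated twice: conditioning on `V` gives the mixed
    -- moment, conditioning on `T ∘ V` the second moment.
    · exact (lintegral_indicator_mul_of_hasCondDistrib h1 hV hA (hκ.comp hT)).symm.trans
        (lintegral_indicator_mul_of_hasCondDistrib h2 (hT.comp hV) hA hκ)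
    · have e1 := lintegral_map (μ := P) (hκ.mul hκ) hV
      have e2 := lintegral_map (μ := P) (hκ.mul hκ) (hT.comp hV)
      rw [hlaw] at e2
      exact e1.symm.trans e2
  -- The null set in `hset` depends on `A`. Uniqueness of disintegrations into a standard Borel
  -- space upgrades this to equality of measures off one null set.
  have hcomap : P.map (fun ω => (V ω, U ω)) = P.map V ⊗ₘ κ.comap T hT := by
    rw [h1.map_eq]
    refine Measure.ext_prod fun {s t} hs ht => ?_
    rw [Measure.compProd_apply_prod hs ht, Measure.compProd_apply_prod hs ht,
      setLIntegral_map hs (κ.measurable_coe ht) hV,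
      setLIntegral_map hs ((κ.comap T hT).measurable_coe ht) hV]
    exact lintegral_congr_ae (ae_restrict_of_ae (hset t ht))
  have u1 := condDistrib_ae_eq_of_measure_eq_compProd V hU.aemeasurable h1.map_eq
  have u2 := condDistrib_ae_eq_of_measure_eq_compProd V hU.aemeasurable hcomap
  filter_upwards [ae_of_ae_map hV.aemeasurable u1, ae_of_ae_map hV.aemeasurable u2] with ω e1 e2
  rw [← e1, e2, Kernel.comap_apply]

/-! ### From one-step conditioning to the product law -/

/-- A sequence is conditionally i.i.d. given `M` if, conditionally on the future, each term has
distribution `M`. -/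
theorem lintegral_prod_indicator_mul {P : Measure Ω} [SFinite P] {X : ℕ → Ω → E}
    (hX : ∀ n, Measurable (X n)) {κ : Kernel (ℕ → E) E} [IsMarkovKernel κ]
    {M : Ω → ProbabilityMeasure E}
    (hκ : ∀ n, HasCondDistrib (X n) (path fun m => X (n + 1 + m)) κ P)
    (hM : ∀ n, ∀ᵐ ω ∂P, κ (path (fun m => X (n + 1 + m)) ω) = M ω) (k : ℕ) :
    ∀ (n : ℕ) (A : ℕ → Set E), (∀ i, MeasurableSet (A i)) →
      ∀ g : ProbabilityMeasure E → ℝ≥0∞, Measurable g →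
      ∫⁻ ω, (∏ i ∈ Finset.range k, (A i).indicator 1 (X (n + i) ω)) * g (M ω) ∂P =
        ∫⁻ ω, (∏ i ∈ Finset.range k, (M ω : Measure E) (A i)) * g (M ω) ∂P := by
  induction k with
  | zero => simp
  | succ k ih =>
    intro n A hA g hg
    let Y : Ω → ℕ → E := path fun m => X (n + 1 + m)
    have hY : Measurable Y := measurable_path fun m => hX _
    let K : (ℕ → E) → ProbabilityMeasure E := fun y => ⟨κ y, inferInstance⟩
    have hK : Measurable K := κ.measurable.subtype_mk
    have hKM : ∀ᵐ ω ∂P, K (Y ω) = M ω := (hM n).mono fun ω h => Subtype.ext h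
    -- Since `M` is almost surely `K (Y ω)`, everything except the factor of `X n` is a function of
    -- the future.
    let H : (ℕ → E) → ℝ≥0∞ := fun y =>
      (∏ i ∈ Finset.range k, (A (i + 1)).indicator 1 (y i)) * g (K y)
    have hH : Measurable H :=
      (Finset.measurable_fun_prod _ fun i _ =>
        (measurable_one.indicator (hA (i + 1))).comp (measurable_pi_apply i)).mul (hg.comp hK)
    have heval : Measurable fun μ : ProbabilityMeasure E => (μ : Measure E) (A 0) :=
      (Measure.measurable_coe (hA 0)).comp measurable_subtype_coe
    calc ∫⁻ ω, (∏ i ∈ Finset.range (k + 1), (A i).indicator 1 (X (n + i) ω)) * g (M ω) ∂P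
        = ∫⁻ ω, (A 0).indicator 1 (X n ω) * H (Y ω) ∂P := by
          refine lintegral_congr_ae ?_
          filter_upwards [hKM] with ω h
          simp only [H, h, Finset.prod_range_succ', Y, path, add_zero]
          simp only [add_assoc, add_comm 1]
          ring
      _ = ∫⁻ ω, κ (Y ω) (A 0) * H (Y ω) ∂P :=
          lintegral_indicator_mul_of_hasCondDistrib (hκ n) hY (hA 0) hH
      _ = ∫⁻ ω, (∏ i ∈ Finset.range k, (A (i + 1)).indicator 1 (X (n + 1 + i) ω)) *
            ((M ω : Measure E) (A 0) * g (M ω)) ∂P := by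
          refine lintegral_congr_ae ?_
          filter_upwards [hKM] with ω h
          have h' : κ (Y ω) = (M ω : Measure E) := congrArg Subtype.val h
          simp only [H, h, h', Y, path]
          ring
      -- The factor `M(A 0)` joins the weight, which is why the induction runs over all `g` and all
      -- starting points `n`.
      _ = ∫⁻ ω, (∏ i ∈ Finset.range k, (M ω : Measure E) (A (i + 1))) *
            ((M ω : Measure E) (A 0) * g (M ω)) ∂P :=
          ih (n + 1) (fun i => A (i + 1)) (fun i => hA _) _ (heval.mul hg)
      _ = _ := by
          refine lintegral_congr fun ω => ?_
          rw [Finset.prod_range_succ']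
          ring

/-- The value of `iidKernel` on a box. -/
theorem iidKernel_pi (μ : ProbabilityMeasure E) (s : Finset ℕ) {t : ℕ → Set E}
    (ht : ∀ i, MeasurableSet (t i)) :
    iidKernel E μ ((s : Set ℕ).pi t) = ∏ i ∈ s, (μ : Measure E) (t i) :=
  Measure.infinitePi_pi _ fun i _ => ht i

/-- The product formula on boxes determines the conditional distribution. -/
theorem hasCondDistrib_iidKernel {P : Measure Ω} [IsFiniteMeasure P] {X : ℕ → Ω → E}
    (hX : ∀ n, Measurable (X n)) {M : Ω → ProbabilityMeasure E} (hM : Measurable M)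
    (h : ∀ (k : ℕ) (A : ℕ → Set E), (∀ i, MeasurableSet (A i)) →
      ∀ g : ProbabilityMeasure E → ℝ≥0∞, Measurable g →
      ∫⁻ ω, (∏ i ∈ Finset.range k, (A i).indicator 1 (X i ω)) * g (M ω) ∂P =
        ∫⁻ ω, (∏ i ∈ Finset.range k, (M ω : Measure E) (A i)) * g (M ω) ∂P) :
    HasCondDistrib (path X) M (iidKernel E) P := by
  have hpath : Measurable (path X) := measurable_path hX
  refine ⟨(hM.prodMk hpath).aemeasurable, Measure.ext_prod fun {B C} hB hC => ?_⟩
  -- With `B` fixed, both sides are finite measures in `C`, so agreement on boxes suffices.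
  suffices hmeas : (P.restrict (M ⁻¹' B)).map (path X) =
      ((P.restrict (M ⁻¹' B)).map M).bind (iidKernel E) by
    rw [Measure.compProd_apply_prod hB hC, Measure.map_apply (hM.prodMk hpath) (hB.prod hC),
      Measure.restrict_map hM hB, ← Measure.bind_apply hC (iidKernel E).aemeasurable, ← hmeas,
      Measure.map_apply hpath hC, Measure.restrict_apply (hpath hC), Set.mk_preimage_prod,
      Set.inter_comm]
  have hbox : ∀ (s : Finset ℕ) (t : ℕ → Set E), (∀ i, MeasurableSet (t i)) →
      (P.restrict (M ⁻¹' B)).map (path X) ((s : Set ℕ).pi t) =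
        ((P.restrict (M ⁻¹' B)).map M).bind (iidKernel E) ((s : Set ℕ).pi t) := by
    intro s t ht
    have hst : MeasurableSet ((s : Set ℕ).pi t) :=
      MeasurableSet.pi s.countable_toSet fun i _ => ht i
    obtain ⟨k, hk⟩ := s.exists_nat_subset_range
    classical
    let A : ℕ → Set E := fun i => if i ∈ s then t i else Set.univ
    have hA : ∀ i, MeasurableSet (A i) := fun i => by
      by_cases hi : i ∈ s <;> simp [A, hi, ht]
    have hsA : (s : Set ℕ).pi t = ((Finset.range k : Finset ℕ) : Set ℕ).pi A := by
      ext x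
      simp only [Set.mem_pi, SetLike.mem_coe, A]
      refine ⟨fun hx i _ => ?_, fun hx i hi => ?_⟩
      · by_cases hi : i ∈ s <;> simp [hi, hx]
      · simpa [hi] using hx i (hk hi)
    have hind := h k A hA (B.indicator 1) (measurable_one.indicator hB)
    have hrestr : ∀ f : Ω → ℝ≥0∞, ∫⁻ ω, f ω * B.indicator 1 (M ω) ∂P =
        ∫⁻ ω in M ⁻¹' B, f ω ∂P := fun f => by
      rw [← lintegral_indicator (hM hB)]
      refine lintegral_congr fun ω => ?_
      by_cases hω : M ω ∈ B <;> simp [hω]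
    rw [hrestr, hrestr] at hind
    rw [Measure.bind_apply hst (iidKernel E).aemeasurable,
      lintegral_map ((iidKernel E).measurable_coe hst) hM, Measure.map_apply hpath hst, hsA]
    simp only [iidKernel_pi _ _ hA]
    rw [← hind, ← lintegral_indicator_one (hpath (hsA ▸ hst))]
    refine lintegral_congr fun ω => ?_
    simp only [Set.indicator_apply, Finset.prod_ite_zero]
    simp [path, Set.mem_pi]
  refine ext_of_generate_finite
    (squareCylinders (fun _ : ℕ => {s : Set E | MeasurableSet s}))
    (generateFrom_squareCylinders (α := fun _ : ℕ => E)).symm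
    (isPiSystem_squareCylinders (fun _ => MeasurableSpace.isPiSystem_measurableSet)
      (fun _ => MeasurableSet.univ)) ?_ ?_
  · rintro _ ⟨s, t, ht, rfl⟩
    exact hbox s t fun i => ht i (Set.mem_univ i)
  -- The box over no coordinates is the whole space, which gives equal total masses.
  · simpa using hbox ∅ (fun _ => Set.univ) fun _ => MeasurableSet.univ

/-! ### Construction of the directing measure -/

/-- The directing random measure of an exchangeable sequence. -/
theorem Exchangeable.exists_hasCondDistrib [StandardBorelSpace E] {P : Measure Ω}
    [IsProbabilityMeasure P] {X : ℕ → Ω → E} (hX : ∀ n, Measurable (X n))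
    (h : Exchangeable X P) :
    ∃ M : Ω → ProbabilityMeasure E, Measurable M ∧
      HasCondDistrib (path X) M (iidKernel E) P := by
  have : Nonempty E := (nonempty_of_isProbabilityMeasure P).map (X 0)
  let Y : ℕ → Ω → ℕ → E := fun n => path fun m => X (n + m)
  have hY : ∀ n, Measurable (Y n) := fun n => measurable_path fun m => hX _
  let κ : Kernel (ℕ → E) E := condDistrib (X 0) (Y 1) P
  let split : (ℕ → E) → (ℕ → E) × E := fun x => (fun m => x (m + 1), x 0)
  have hsplit : Measurable split := by fun_prop
  have hpair : ∀ n j, P.map (fun ω => (Y (n + 1 + j) ω, X n ω)) =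
      P.map (fun ω => (Y 1 ω, X 0 ω)) := by
    intro n j
    -- Reindexing by `φ` puts `X n` at the head and `Y (n + 1 + j)` in the tail; the gap `j` allows
    -- conditioning on a strictly later future.
    let φ : ℕ → ℕ := fun i => if i = 0 then n else n + j + i
    have hφ : Function.Injective φ := fun a b hab => by
      simp only [φ] at hab
      split_ifs at hab <;> omega
    have key := congrArg (fun ν => ν.map split) (h.map_comp_injective hX hφ)
    rw [Measure.map_map hsplit (measurable_path fun m => hX _),
      Measure.map_map hsplit (measurable_path hX)] at key
    convert key using 2
    · funext ω
      refine Prod.ext (funext fun m => ?_) ?_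
      · simp only [Y, path, split, φ, Function.comp]
        simp only [Nat.succ_ne_zero, if_false]
        congr 1
        omega
      · simp [path, split, φ]
    · funext ω
      refine Prod.ext (funext fun m => ?_) rfl
      simp only [Y, path, split, Function.comp, add_comm]
  have hYlaw : ∀ n j, P.map (Y (n + 1 + j)) = P.map (Y 1) := by
    intro n j
    have key := congrArg Measure.fst (hpair n j)
    rwa [Measure.fst_map_prodMk (hX _), Measure.fst_map_prodMk (hX _)] at key
  have hcond : ∀ n j, HasCondDistrib (X n) (Y (n + 1 + j)) κ P := by
    intro n j
    refine ⟨((hY _).prodMk (hX _)).aemeasurable, ?_⟩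
    rw [hpair, hYlaw, compProd_map_condDistrib (hX 0).aemeasurable]
  let M : Ω → ProbabilityMeasure E := fun ω => ⟨κ (Y 1 ω), inferInstance⟩
  have hM : Measurable M := (κ.measurable.comp (hY 1)).subtype_mk
  have hconst : ∀ n, ∀ᵐ ω ∂P, κ (Y (n + 1) ω) = M ω := by
    intro n
    let T : (ℕ → E) → ℕ → E := fun x m => x (n + m)
    have hT : Measurable T := by fun_prop
    have hTY : T ∘ Y 1 = Y (0 + 1 + n) := by
      funext ω m
      simp only [T, Y, path, Function.comp, zero_add, add_assoc]
    have key := ae_eq_comp_of_hasCondDistrib (hX 0) (hY 1) hT (hcond 0 0)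
      (hTY ▸ hcond 0 n) (hTY ▸ hYlaw 0 n)
    filter_upwards [key] with ω hω
    have e : T (Y 1 ω) = Y (n + 1) ω := by
      rw [← Function.comp_apply (f := T), hTY, zero_add, add_comm]
    rw [← e, ← hω]
    rfl
  refine ⟨M, hM, hasCondDistrib_iidKernel hX hM fun k A hA g hg => ?_⟩
  simpa using lintegral_prod_indicator_mul hX (fun n => hcond n 0) hconst k 0 A hA g hg

end DeFinetti

theorem theorem1 {Ω E : Type*} [MeasurableSpace Ω] [MeasurableSpace E] [StandardBorelSpace E]
    (P : Measure Ω) [IsProbabilityMeasure P]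
    (X : ℕ → Ω → E) (hX : ∀ n, Measurable (X n)) (hexch : DeFinetti.Exchangeable X P) :
    ∃ M : Ω → ProbabilityMeasure E, Measurable M ∧
      -- conditionally on `M = μ`, the sequence `X` has law `μ^{⊗ℕ}`
      HasCondDistrib (DeFinetti.path X) M (DeFinetti.iidKernel E) P ∧
      -- finite-dimensional mixture formula
      (∀ (k : ℕ) (A : Fin k → Set E), (∀ i, MeasurableSet (A i)) →
        P {ω | ∀ i : Fin k, X i ω ∈ A i} =
          ∫⁻ μ : ProbabilityMeasure E, ∏ i : Fin k, (μ : Measure E) (A i) ∂(P.map M)) ∧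
      -- mixture formula on the path space
      (∀ A : Set (ℕ → E), MeasurableSet A →
        P {ω | DeFinetti.path X ω ∈ A} =
          ∫⁻ μ : ProbabilityMeasure E, DeFinetti.iidKernel E μ A ∂(P.map M)) := by

  obtain ⟨M, hM, hcond⟩ := hexch.exists_hasCondDistrib hX
  have hpath : Measurable (DeFinetti.path X) := DeFinetti.measurable_path hX
  have hmix : ∀ A : Set (ℕ → E), MeasurableSet A → P {ω | DeFinetti.path X ω ∈ A} =
      ∫⁻ μ : ProbabilityMeasure E, DeFinetti.iidKernel E μ A ∂(P.map M) := by
    intro A hA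
    have h := congrArg (fun ν => ν (Set.univ ×ˢ A)) hcond.map_eq
    rw [Measure.compProd_apply_prod MeasurableSet.univ hA,
      Measure.map_apply (hM.prodMk hpath) (MeasurableSet.univ.prod hA), setLIntegral_univ] at h
    rw [← h]
    congr 1
    ext ω
    simp
  refine ⟨M, hM, hcond, fun k A hA => ?_, hmix⟩
  let t : ℕ → Set E := fun i => if h : i < k then A ⟨i, h⟩ else Set.univ
  have ht : ∀ i, MeasurableSet (t i) := fun i => by
    by_cases hi : i < k <;> simp [t, hi, hA]
  have h := hmix _ (MeasurableSet.pi (Finset.range k).countable_toSet fun i _ => ht i)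
  simp only [DeFinetti.iidKernel_pi _ _ ht] at h
  convert h using 2
  · ext ω
    simp only [Set.mem_ofPred_eq, Set.mem_pi, SetLike.mem_coe, Finset.mem_range, DeFinetti.path]
    exact ⟨fun hω i hi => by simpa [t, hi] using hω ⟨i, hi⟩,
      fun hω i => by simpa [t] using hω i i.2⟩
  · funext μ
    rw [← Fin.prod_univ_eq_prod_range (fun i => (μ : Measure E) (t i))]
    simp [t]
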